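/- A Jordan curve is a continuous injective map $\gamma : S^1 \to \mathbb{R}^2$. For $\theta \in \mathbb{R}$, a line of angle $\theta$ is a line of the form $\{(x,y) : x\sin\theta - y\cos\theta = c\}$ with $c \in \mathbb{R}$. A point $p \in \gamma(S^1)$ is a special corner of $\gamma$ if there is $\theta \in \mathbb{R}$ such that both the line of angle $\theta$ through $p$ and the line of angle $\theta + \frac{\pi}{2}$ through $p$ meet $\gamma(S^1)$ only at $p$. We say that $\gamma$ inscribes a rhombus of angle $\theta$ if there are four distinct points of $\gamma(S^1)$ that are the vertices of a rhombus whose two diagonals lie on a line of angle $\theta$ and a line of angle $\theta + \frac{\pi}{2}$ respectively. Theorem. Let $\gamma : S^1 \to \mathbb{R}^2$ be a Jordan curve. Then there are real numbers $a < b$ such that, for every $\theta \in (a,b)$, $\gamma$ inscribes a rhombus of angle $\theta$. Furthermore, if $\gamma$ has no special corner, then $\gamma$ inscribes a rhombus of angle $\theta$ for every $\theta \in \mathbb{R}$. -/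

import Mathlib

open Real Set

/-- The plane `ℝ²` with its Euclidean metric. -/
abbrev Plane : Type := EuclideanSpace ℝ (Fin 2)

/-- A Jordan curve: a continuous injective map from the unit circle to the plane. -/
structure IsJordanCurve (γ : Circle → Plane) : Prop where
  continuous : Continuous γ
  injective : Function.Injective γ

/-- The line of angle `θ` through `p`, i.e. the line of the form `x sin θ - y cos θ = const`
that contains `p`. -/
def lineOfAngle (θ : ℝ) (p : Plane) : Set Plane :=
  {z | z 0 * sin θ - z 1 * cos θ = p 0 * sin θ - p 1 * cos θ}

/-- `p` is a special corner of `γ` of angle `θ`: it lies on the curve, and the lines of angles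
`θ` and `θ + π / 2` through `p` meet the curve at `p` only. -/
def IsSpecialCornerOfAngle (γ : Circle → Plane) (θ : ℝ) (p : Plane) : Prop :=
  p ∈ range γ ∧
    lineOfAngle θ p ∩ range γ = {p} ∧
    lineOfAngle (θ + π / 2) p ∩ range γ = {p}

/-- `p` is a special corner of `γ` (of at least one angle). -/
def IsSpecialCorner (γ : Circle → Plane) (p : Plane) : Prop :=
  ∃ θ : ℝ, IsSpecialCornerOfAngle γ θ p

/-- `v 0, v 1, v 2, v 3` are, in this cyclic order, the vertices of a rhombus: they are four
distinct points, and the four sides `v i, v (i + 1)` (indices modulo 4) have equal length. -/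
def IsRhombus (v : Fin 4 → Plane) : Prop :=
  Function.Injective v ∧ ∀ i j : Fin 4, dist (v i) (v (i + 1)) = dist (v j) (v (j + 1))

/-- A rhombus of angle `θ`: the line through the opposite vertices `v 0, v 2` has angle `θ` and
the line through the opposite vertices `v 1, v 3` has angle `θ + π / 2`. -/
def IsRhombusOfAngle (θ : ℝ) (v : Fin 4 → Plane) : Prop :=
  IsRhombus v ∧
    (line[ℝ, v 0, v 2] : Set Plane) = lineOfAngle θ (v 0) ∧
    (line[ℝ, v 1, v 3] : Set Plane) = lineOfAngle (θ + π / 2) (v 1)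

/-- `γ` inscribes a rhombus of angle `θ`: all four vertices lie on the curve. -/
def InscribesRhombusOfAngle (γ : Circle → Plane) (θ : ℝ) : Prop :=
  ∃ v : Fin 4 → Plane, IsRhombusOfAngle θ v ∧ ∀ i, v i ∈ range γ

/-! For a fixed angle, let h and k be the transverse and along coordinates on the curve. A rhombus
of that angle amounts to two nondegenerate chords with a common midpoint, h being constant on the
ends of one and k on the ends of the other. The ends of the first are sought on two arcs from a
maximum to a minimum of h, those of the second on two such arcs for k. The four equations form a map
of the 4-cube whose coordinates have weakly opposite signs on opposite faces, so the
Poincaré–Miranda theorem (`exists_eq_zero_of_faces`, via mod 2 cup products) yields a zero.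

The arcs of each pair meet only at strict extrema (`exists_arcs`), so a degenerate zero, or one on
the boundary, would give a point that is a strict extremum of both h and k, hence a special corner.
If there is none, zeros avoid a compact set, and this persists for nearby angles
(`exists_eq_zero_of_dist_lt`, `eventually_inscribesRhombusOfAngle`). For the first claim, the
direction of a diameter never has such a point. -/

/-! ### Mod 2 cup products on a cubical grid -/

/-- The value at the cube with lower vertex `v` and edge directions `S` of the cup product
(modulo 2) of the coboundaries of the functions in a list. -/
def cubeCup {ι : Type*} [DecidableEq ι] :
    List ((ι → ℕ) → ZMod 2) → Finset ι → (ι → ℕ) → ZMod 2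
  | [], _, _ => 1
  | f :: fs, S, v => ∑ j ∈ S,
      (f (v + Pi.single j 1) + f v) * cubeCup fs (S.erase j) (v + Pi.single j 1)

section CubeCup

variable {ι : Type*} [DecidableEq ι]

/-- The terms at (i, j) and (j, i) cancel in characteristic 2. -/
lemma sum_erase_symm_eq_zero (S : Finset ι) (g : ι → ι → ZMod 2) (hg : ∀ i j, g i j = g j i) :
    ∑ i ∈ S, ∑ j ∈ S.erase i, g i j = 0 := by
  induction S using Finset.induction_on with
  | empty => simp
  | insert a S ha ih =>
    have h1 : ∀ i ∈ S, ∑ j ∈ (insert a S).erase i, g i j = g i a + ∑ j ∈ S.erase i, g i j := by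
      intro i hi
      have hne : a ≠ i := fun h => ha (h ▸ hi)
      rw [Finset.erase_insert_of_ne hne, Finset.sum_insert (by simp [ha])]
    rw [Finset.sum_insert ha, Finset.sum_congr rfl h1, Finset.sum_add_distrib, ih,
      Finset.erase_insert ha, Finset.sum_congr rfl (fun i _ => hg a i), add_zero]
    exact CharTwo.add_self_eq_zero _

lemma sum_erase_comm (S : Finset ι) (g : ι → ι → ZMod 2) :
    ∑ i ∈ S, ∑ j ∈ S.erase i, g i j = ∑ i ∈ S, ∑ j ∈ S.erase i, g j i := by
  refine Finset.sum_comm' ?_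
  intro x y
  simp only [Finset.mem_erase]
  tauto

/-- The cup product of coboundaries is a cocycle. -/
lemma cubeCup_closed (fs : List ((ι → ℕ) → ZMod 2)) :
    ∀ (S : Finset ι), S.card = fs.length + 1 → ∀ v : ι → ℕ,
      ∑ j ∈ S, (cubeCup fs (S.erase j) (v + Pi.single j 1) + cubeCup fs (S.erase j) v) = 0 := by
  induction fs with
  | nil =>
    intro S _ v
    refine Finset.sum_eq_zero fun j _ => ?_
    simp only [cubeCup]
    exact CharTwo.add_self_eq_zero _
  | cons f gs ih =>
    intro S hS v
    have hcard : ∀ j ∈ S, (S.erase j).card = gs.length + 1 := by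
      intro j hj
      rw [Finset.card_erase_of_mem hj, hS]; simp
    -- Closedness of the tail allows its base point to be shifted back along l. After expansion, two
    -- of the four double sums become symmetric and vanish; the other two coincide.
    have key : ∀ j ∈ S, ∑ l ∈ S.erase j, cubeCup gs ((S.erase j).erase l) (v + Pi.single l 1)
        = ∑ l ∈ S.erase j, cubeCup gs ((S.erase j).erase l) v := by
      intro j hj
      have := ih _ (hcard j hj) v
      rwa [Finset.sum_add_distrib, CharTwo.add_eq_zero] at this
    have key2 : ∀ j ∈ S,
        ∑ l ∈ S.erase j, cubeCup gs ((S.erase j).erase l) (v + Pi.single j 1 + Pi.single l 1)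
        = ∑ l ∈ S.erase j, cubeCup gs ((S.erase j).erase l) (v + Pi.single j 1) := by
      intro j hj
      have := ih _ (hcard j hj) (v + Pi.single j 1)
      rwa [Finset.sum_add_distrib, CharTwo.add_eq_zero] at this
    have comm : ∀ j l, (S.erase j).erase l = (S.erase l).erase j :=
      fun j l => Finset.erase_right_comm
    have e1 : ∑ j ∈ S, ∑ l ∈ S.erase j, f (v + Pi.single j 1 + Pi.single l 1) *
        cubeCup gs ((S.erase j).erase l) (v + Pi.single j 1 + Pi.single l 1) = 0 := by
      apply sum_erase_symm_eq_zero
      intro i j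
      rw [comm, add_right_comm]
    have e2 : ∑ j ∈ S, ∑ l ∈ S.erase j, f (v + Pi.single j 1) *
        cubeCup gs ((S.erase j).erase l) (v + Pi.single j 1 + Pi.single l 1)
        = ∑ j ∈ S, ∑ l ∈ S.erase j, f (v + Pi.single l 1) *
        cubeCup gs ((S.erase j).erase l) (v + Pi.single l 1) := by
      conv_rhs => rw [sum_erase_comm]
      refine Finset.sum_congr rfl fun j hj => ?_
      rw [← Finset.mul_sum, key2 j hj, Finset.mul_sum]
      exact Finset.sum_congr rfl fun l _ => by rw [comm]
    have e3 : ∑ j ∈ S, ∑ l ∈ S.erase j, f v *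
        cubeCup gs ((S.erase j).erase l) (v + Pi.single l 1) = 0 := by
      rw [Finset.sum_congr rfl fun j hj => by
        rw [← Finset.mul_sum, key j hj, Finset.mul_sum]]
      apply sum_erase_symm_eq_zero
      intro i j
      rw [comm]
    simp only [cubeCup, add_mul, Finset.sum_add_distrib]
    rw [e1, e2, e3, zero_add, add_zero]
    exact CharTwo.add_self_eq_zero _

/-- Leibniz rule: since the tail c is closed, δf ∪ c = δ(f c), a form that telescopes. -/
lemma cubeCup_cons_eq (f : (ι → ℕ) → ZMod 2) (gs : List ((ι → ℕ) → ZMod 2)) (S : Finset ι)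
    (hS : S.card = gs.length + 1) (v : ι → ℕ) :
    cubeCup (f :: gs) S v = ∑ j ∈ S,
      (f (v + Pi.single j 1) * cubeCup gs (S.erase j) (v + Pi.single j 1) +
        f v * cubeCup gs (S.erase j) v) := by
  have h := cubeCup_closed gs S hS v
  rw [Finset.sum_add_distrib, CharTwo.add_eq_zero] at h
  simp only [cubeCup, add_mul, Finset.sum_add_distrib]
  rw [← Finset.mul_sum, ← Finset.mul_sum, h]

lemma cubeCup_eq_zero (j : ι) (c : ZMod 2) (m : ℕ) (f : (ι → ℕ) → ZMod 2)
    (hf : ∀ v, v j = m → f v = c) (fs : List ((ι → ℕ) → ZMod 2)) (hmem : f ∈ fs) :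
    ∀ (S : Finset ι), j ∉ S → ∀ v : ι → ℕ, v j = m → cubeCup fs S v = 0 := by
  induction fs with
  | nil => simp at hmem
  | cons g gs ih =>
    intro S hj v hv
    simp only [cubeCup]
    refine Finset.sum_eq_zero fun l hl => ?_
    have hne : j ≠ l := fun h => hj (h ▸ hl)
    have hv' : (v + Pi.single l 1 : ι → ℕ) j = m := by simp [hne, hv]
    rcases List.mem_cons.1 hmem with rfl | h
    · rw [hf _ hv, hf _ hv', CharTwo.add_self_eq_zero, zero_mul]
    · rw [ih h _ (fun hh => hj (Finset.mem_of_mem_erase hh)) _ hv', mul_zero]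

/-- A nonzero product of edge differences has no zero factor, and each factor lives on an edge of
the cube. -/
lemma exists_ne_of_cubeCup_ne_zero (fs : List ((ι → ℕ) → ZMod 2)) :
    ∀ (S : Finset ι) (v : ι → ℕ), cubeCup fs S v ≠ 0 → ∀ f ∈ fs, ∃ a b : ι → ℕ, f a ≠ f b ∧
      ∀ k, (v k ≤ a k ∧ a k ≤ v k + if k ∈ S then 1 else 0) ∧
        (v k ≤ b k ∧ b k ≤ v k + if k ∈ S then 1 else 0) := by
  induction fs with
  | nil => simp
  | cons g gs ih =>
    intro S v hv f hf
    simp only [cubeCup] at hv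
    obtain ⟨j, hj, hne⟩ := Finset.exists_ne_zero_of_sum_ne_zero hv
    rcases List.mem_cons.1 hf with rfl | h
    · refine ⟨v + Pi.single j 1, v, ?_, ?_⟩
      · intro h
        rw [h, CharTwo.add_self_eq_zero, zero_mul] at hne
        exact hne rfl
      · intro k
        by_cases hk : k = j
        · subst hk; simp [hj]
        · simp [hk]
    · obtain ⟨a, b, hab, H⟩ := ih _ _ (right_ne_zero_of_mul hne) f h
      refine ⟨a, b, hab, fun k => ?_⟩
      have := H k
      by_cases hk : k = j
      · subst hk
        simp [hj] at this ⊢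
        omega
      · simp [hk] at this ⊢
        exact this

variable [Fintype ι]

/-- The lower vertices of the unit cubes with directions `S` in a face of the cube of side `N`. -/
def faceBox (N : ℕ) (S : Finset ι) : Finset (ι → ℕ) :=
  Fintype.piFinset fun i => if i ∈ S then Finset.range N else {N}

/-- Grouping by lines in direction j leaves only the two end values of each line. -/
lemma sum_faceBox_telescope (N : ℕ) (S : Finset ι) (j : ι) (hj : j ∈ S)
    (g : (ι → ℕ) → ZMod 2) :
    ∑ v ∈ faceBox N S, (g (v + Pi.single j 1) + g v) =
      ∑ v ∈ faceBox N (S.erase j), (g v + g (Function.update v j 0)) := by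
  have hmaps : ∀ v ∈ faceBox N S, Function.update v j N ∈ faceBox N (S.erase j) := by
    intro v hv
    simp only [faceBox, Fintype.mem_piFinset] at hv ⊢
    intro i
    by_cases hi : i = j
    · subst hi; simp
    · simpa [hi] using hv i
  rw [← Finset.sum_fiberwise_of_maps_to hmaps]
  refine Finset.sum_congr rfl fun w hw => ?_
  have hwj : w j = N := by
    have := Fintype.mem_piFinset.1 hw j
    simpa using this
  have hsum : ∑ v ∈ faceBox N S with Function.update v j N = w, (g (v + Pi.single j 1) + g v)
      = ∑ m ∈ Finset.range N,
        (g (Function.update w j (m + 1)) + g (Function.update w j m)) := by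
    refine Finset.sum_bij' (fun v _ => v j) (fun m _ => Function.update w j m) ?_ ?_ ?_ ?_ ?_
    · intro v hv
      have := Fintype.mem_piFinset.1 (Finset.mem_filter.1 hv).1 j
      simpa [hj] using this
    · intro m hm
      simp only [Finset.mem_filter, Function.update_idem]
      refine ⟨?_, by rw [← hwj, Function.update_eq_self]⟩
      simp only [faceBox, Fintype.mem_piFinset] at hw ⊢
      intro i
      by_cases hi : i = j
      · subst hi; simpa [hj] using hm
      · simpa [hi] using hw i
    · intro v hv
      rw [← (Finset.mem_filter.1 hv).2]; simp
    · intro m hm; simp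
    · intro v hv
      rw [← (Finset.mem_filter.1 hv).2]
      congr 2
      · funext i
        by_cases hi : i = j
        · subst hi; simp
        · simp [hi]
      · simp
  rw [hsum]
  have tel : ∀ M : ℕ, ∑ m ∈ Finset.range M,
      (g (Function.update w j (m + 1)) + g (Function.update w j m))
      = g (Function.update w j M) + g (Function.update w j 0) := by
    intro M
    induction M with
    | zero => simp [CharTwo.add_self_eq_zero]
    | succ M ih =>
      rw [Finset.sum_range_succ, ih, add_comm, add_assoc, ← add_assoc (g _) (g _) (g _),
        CharTwo.add_self_eq_zero, zero_add]
  rw [tel, ← hwj, Function.update_eq_self]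

/-- Stokes and induction: on the two faces normal to j ≠ i, the factor `ε j` is constant and kills
the product; normal to i, only the top face survives, with weight 1. Hence the free coordinates are
frozen at N in `faceBox`. -/
lemma sum_cubeCup_eq_one (N : ℕ) (ε : ι → (ι → ℕ) → ZMod 2)
    (h0 : ∀ i v, v i = 0 → ε i v = 0) (h1 : ∀ i v, v i = N → ε i v = 1) (l : List ι)
    (hl : l.Nodup) :
    ∑ v ∈ faceBox N l.toFinset, cubeCup (l.map ε) l.toFinset v = 1 := by
  induction l with
  | nil => simp [cubeCup, faceBox]
  | cons i l ih =>
    obtain ⟨hi, hl⟩ := List.nodup_cons.1 hl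
    have hi' : i ∉ l.toFinset := by simpa using hi
    have hcard : (i :: l).toFinset.card = (l.map ε).length + 1 := by
      rw [List.toFinset_card_of_nodup (List.nodup_cons.2 ⟨hi, hl⟩)]; simp
    rw [List.map_cons, Finset.sum_congr rfl fun v _ => cubeCup_cons_eq _ _ _ hcard v,
      Finset.sum_comm, Finset.sum_congr rfl fun j hj => sum_faceBox_telescope N _ j hj
        (fun v => ε i v * cubeCup (l.map ε) ((i :: l).toFinset.erase j) v)]
    have herase : (i :: l).toFinset.erase i = l.toFinset := by
      rw [List.toFinset_cons, Finset.erase_insert hi']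
    have hface : ∀ j, ∀ v ∈ faceBox N ((i :: l).toFinset.erase j), v j = N := by
      intro j v hv
      simpa using Fintype.mem_piFinset.1 hv j
    rw [Finset.sum_eq_single_of_mem i (by simp)]
    · rw [herase, ← ih hl]
      refine Finset.sum_congr rfl fun v hv => ?_
      rw [h1 i v (hface i v (herase ▸ hv)), h0 i _ (Function.update_self ..)]
      ring
    · intro j hj hne
      have hjl : ε j ∈ l.map ε := by
        refine List.mem_map_of_mem ?_
        have : j = i ∨ j ∈ l := by simpa using hj
        exact this.resolve_left hne
      refine Finset.sum_eq_zero fun v hv => ?_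
      rw [cubeCup_eq_zero j 1 N _ (h1 j) _ hjl _ (by simp) _ (hface j v hv),
        cubeCup_eq_zero j 0 0 _ (h0 j) _ hjl _ (by simp) _ (Function.update_self ..)]
      ring

/-- A combinatorial form of the Poincaré–Miranda theorem. -/
lemma exists_unit_cube_forall_ne (N : ℕ) (ε : ι → (ι → ℕ) → ZMod 2)
    (h0 : ∀ i v, v i = 0 → ε i v = 0) (h1 : ∀ i v, v i = N → ε i v = 1) :
    ∃ v : ι → ℕ, (∀ k, v k < N) ∧ ∀ i, ∃ a b : ι → ℕ, ε i a ≠ ε i b ∧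
      ∀ k, (v k ≤ a k ∧ a k ≤ v k + 1) ∧ (v k ≤ b k ∧ b k ≤ v k + 1) := by
  have h := sum_cubeCup_eq_one N ε h0 h1 Finset.univ.toList (Finset.nodup_toList _)
  rw [Finset.toList_toFinset] at h
  obtain ⟨v, hv, hne⟩ := Finset.exists_ne_zero_of_sum_ne_zero (h ▸ one_ne_zero)
  refine ⟨v, fun k => by simpa using Fintype.mem_piFinset.1 hv k, fun i => ?_⟩
  simpa using exists_ne_of_cubeCup_ne_zero _ _ _ hne (ε i)
    (List.mem_map_of_mem (Finset.mem_toList.2 (Finset.mem_univ i)))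

/-! ### The Poincaré–Miranda theorem and its stability -/

/-- The Poincaré–Miranda theorem. -/
theorem exists_eq_zero_of_faces {F : (ι → ℝ) → ι → ℝ} (hF : Continuous F)
    (h0 : ∀ x ∈ Icc (0 : ι → ℝ) 1, ∀ i, x i = 0 → 0 ≤ F x i)
    (h1 : ∀ x ∈ Icc (0 : ι → ℝ) 1, ∀ i, x i = 1 → F x i ≤ 0) :
    ∃ x ∈ Icc (0 : ι → ℝ) 1, F x = 0 := by
  by_contra! hno
  have hK : IsCompact (Icc (0 : ι → ℝ) 1) := isCompact_Icc
  obtain ⟨x₀, hx₀, hmin⟩ := hK.exists_isMinOn ⟨0, by simp⟩ hF.norm.continuousOn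
  have hpos : 0 < ‖F x₀‖ := norm_pos_iff.2 (hno x₀ hx₀)
  obtain ⟨δ, hδ, hunif⟩ := Metric.uniformContinuousOn_iff.1
    (hK.uniformContinuousOn_of_continuous hF.continuousOn) ‖F x₀‖ hpos
  obtain ⟨m, hm⟩ := exists_nat_one_div_lt hδ
  set N : ℕ := m + 1 with hN
  have hN0 : (0 : ℝ) < N := by positivity
  let pt : (ι → ℕ) → ι → ℝ := fun v i => v i / N
  have hpt : ∀ v : ι → ℕ, (∀ k, v k ≤ N) → pt v ∈ Icc (0 : ι → ℝ) 1 := by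
    intro v hv
    refine ⟨fun i => by simp only [pt, Pi.zero_apply]; positivity, fun i => ?_⟩
    simp only [pt, Pi.one_apply]
    rw [div_le_one hN0]
    exact_mod_cast hv i
  -- Labels record signs, but are forced on the two faces, where F may vanish.
  let ε : ι → (ι → ℕ) → ZMod 2 := fun i v =>
    if v i = 0 then 0 else if v i = N then 1 else if 0 < F (pt v) i then 0 else 1
  obtain ⟨v, hvN, hv⟩ := exists_unit_cube_forall_ne N ε (fun i v h => by simp [ε, h])
    (fun i v h => by
      have : v i ≠ 0 := by omega
      simp [ε, h, hN])
  have hnonneg : ∀ i a, (∀ k, a k ≤ N) → ε i a = 0 → 0 ≤ F (pt a) i := by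
    intro i a ha h
    by_cases ha0 : a i = 0
    · exact h0 _ (hpt a ha) i (by simp [pt, ha0])
    · by_contra! hneg
      simp only [ε, ha0, if_false, not_lt.2 hneg.le] at h
      split_ifs at h <;> simp at h
  have hnonpos : ∀ i a, (∀ k, a k ≤ N) → ε i a ≠ 0 → F (pt a) i ≤ 0 := by
    intro i a ha h
    by_cases haN : a i = N
    · exact h1 _ (hpt a ha) i (by simp only [pt, haN]; exact div_self hN0.ne')
    · by_contra! hpos
      simp [ε, haN, hpos] at h
  have hvle : ∀ k, v k ≤ N := fun k => (hvN k).le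
  have hdist : ∀ a : ι → ℕ, (∀ k, v k ≤ a k ∧ a k ≤ v k + 1) → dist (pt a) (pt v) < δ := by
    intro a ha
    refine lt_of_le_of_lt ?_ hm
    rw [dist_pi_le_iff (by positivity)]
    intro k
    have h1 : (v k : ℝ) ≤ a k := by exact_mod_cast (ha k).1
    have h2 : (a k : ℝ) ≤ v k + 1 := by exact_mod_cast (ha k).2
    have h3 : ((m : ℝ) + 1) = N := by rw [hN]; push_cast; ring
    simp only [pt]
    rw [Real.dist_eq, ← sub_div, abs_div, abs_of_pos hN0, h3, abs_of_nonneg (by linarith)]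
    gcongr
    linarith
  -- Each coordinate takes both weak signs on the cube and oscillates by less than the minimal norm,
  -- so at v it is below that norm.
  have hlt : ‖F (pt v)‖ < ‖F x₀‖ := by
    rw [pi_norm_lt_iff hpos]
    intro i
    obtain ⟨a, b, hab, hk⟩ := hv i
    have haN : ∀ k, a k ≤ N := fun k => by have := hk k; have := hvN k; omega
    have hbN : ∀ k, b k ≤ N := fun k => by have := hk k; have := hvN k; omega
    have hda := (dist_le_pi_dist _ _ i).trans_lt
      (hunif _ (hpt a haN) _ (hpt v hvle) (hdist a fun k => (hk k).1))
    have hdb := (dist_le_pi_dist _ _ i).trans_lt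
      (hunif _ (hpt b hbN) _ (hpt v hvle) (hdist b fun k => (hk k).2))
    rw [Real.dist_eq, abs_lt] at hda hdb
    rw [Real.norm_eq_abs, abs_lt]
    by_cases h : ε i a = 0
    · have h2 : ε i b ≠ 0 := fun h' => hab (h.trans h'.symm)
      have := hnonneg i a haN h
      have := hnonpos i b hbN h2
      constructor <;> linarith [hda.1, hda.2, hdb.1, hdb.2]
    · have h2 : ε i b = 0 := by
        generalize ε i a = p at *
        generalize ε i b = q at *
        revert p q
        decide
      have := hnonpos i a haN h
      have := hnonneg i b hbN h2
      constructor <;> linarith [hda.1, hda.2, hdb.1, hdb.2]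
  exact absurd hlt (not_lt.2 (hmin (hpt v hvle)))

/-- A zero provided by the Poincaré–Miranda theorem is stable if there is none on the boundary. -/
theorem exists_eq_zero_of_dist_lt {F₀ F : (ι → ℝ) → ι → ℝ} (hF₀ : Continuous F₀)
    (hF : Continuous F)
    (h0 : ∀ x ∈ Icc (0 : ι → ℝ) 1, ∀ i, x i = 0 → 0 ≤ F₀ x i)
    (h1 : ∀ x ∈ Icc (0 : ι → ℝ) 1, ∀ i, x i = 1 → F₀ x i ≤ 0)
    (hclose : ∀ x ∈ Icc (0 : ι → ℝ) 1, ∀ i, (x i = 0 ∨ x i = 1) → dist (F x) (F₀ x) < ‖F₀ x‖) :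
    ∃ x ∈ Icc (0 : ι → ℝ) 1, F x = 0 := by
  -- `r` expands the middle third onto the whole cube and sends the collar to the boundary; `τ` is 0
  -- on the middle third and 1 on the outer boundary. The interpolation is thus F in the middle and
  -- F₀ outside.
  let r : (ι → ℝ) → ι → ℝ := fun x i => max 0 (min 1 (3 * x i - 1))
  let τ : (ι → ℝ) → ℝ := fun x => min 1 ‖3 • x - 1 - r x‖
  have hr : Continuous r := by fun_prop
  have hτ : Continuous τ := by fun_prop
  have hmem : ∀ x, r x ∈ Icc (0 : ι → ℝ) 1 := fun x =>
    ⟨fun i => le_max_left _ _, fun i => max_le zero_le_one (min_le_left _ _)⟩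
  have hτ1 : ∀ x : ι → ℝ, ∀ i, (x i = 0 ∨ x i = 1) → τ x = 1 := by
    intro x i hi
    refine min_eq_left ?_
    refine le_trans ?_ (norm_le_pi_norm _ i)
    rcases hi with hi | hi
    · simp [r, hi]
    · simp [r, hi]; norm_num
  have hG : ∀ x : ι → ℝ, ∀ i, (x i = 0 ∨ x i = 1) →
      F₀ (r x) + (1 - τ x) • (F (r x) - F₀ (r x)) = F₀ (r x) := by
    intro x i hi
    rw [hτ1 x i hi]; simp
  obtain ⟨x, hx, hzero⟩ := exists_eq_zero_of_faces
    (F := fun x => F₀ (r x) + (1 - τ x) • (F (r x) - F₀ (r x))) (by fun_prop)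
    (fun x hx i hi => by
      simp only [hG x i (.inl hi)]
      exact h0 _ (hmem x) i (by simp [r, hi]))
    (fun x hx i hi => by
      simp only [hG x i (.inr hi)]
      exact h1 _ (hmem x) i (by simp [r, hi]; norm_num))
  -- A zero in the collar is excluded by `hclose`; otherwise `r` is not clamped and the zero is one
  -- of F.
  by_cases hint : ∃ i, r x i = 0 ∨ r x i = 1
  · obtain ⟨i, hi⟩ := hint
    exfalso
    have hlt := hclose _ (hmem x) i hi
    have h3 : F₀ (r x) = -((1 - τ x) • (F (r x) - F₀ (r x))) := eq_neg_of_add_eq_zero_left hzero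
    have hτ0 : 0 ≤ τ x := le_min zero_le_one (norm_nonneg _)
    have hτ1 : τ x ≤ 1 := min_le_left _ _
    have h4 : ‖F₀ (r x)‖ = (1 - τ x) * dist (F (r x)) (F₀ (r x)) := by
      conv_lhs => rw [h3]
      rw [norm_neg, norm_smul, dist_eq_norm, Real.norm_of_nonneg (by linarith)]
    nlinarith [dist_nonneg (x := F (r x)) (y := F₀ (r x))]
  · push Not at hint
    have hrx : 3 • x - 1 - r x = 0 := by
      funext i
      have := hint i
      simp only [r] at this ⊢
      have h2 : max 0 (min 1 (3 * x i - 1)) = 3 * x i - 1 := by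
        rcases le_total (3 * x i - 1) 0 with h | h
        · exact absurd (max_eq_left ((min_le_right _ _).trans h)) this.1
        · rcases le_total 1 (3 * x i - 1) with h' | h'
          · exact absurd (by rw [min_eq_left h']; simp) this.2
          · rw [min_eq_right h', max_eq_right h]
      simp [h2]
    refine ⟨r x, hmem x, ?_⟩
    have hτx : τ x = 0 := by simp only [τ, hrx]; simp
    simpa [hτx] using hzero

end CubeCup

/-! ### Arcs from maximum to minimum -/

/-- The point `p` is the only maximum point of `g` or its only minimum point. -/
def IsStrictExtremum {X : Type*} (g : X → ℝ) (p : X) : Prop :=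
  (∀ z ≠ p, g z < g p) ∨ (∀ z ≠ p, g p < g z)

lemma exists_arcs_of_lifts (g : Circle → ℝ) (p q r s : ℝ)
    (hp : ∀ z, g z ≤ g (Circle.exp p)) (hr : ∀ z, g z ≤ g (Circle.exp r))
    (hq : ∀ z, g (Circle.exp q) ≤ g z) (hs : ∀ z, g (Circle.exp s) ≤ g z)
    (H : ∀ x ∈ uIcc p q, ∀ y ∈ uIcc r s, Circle.exp x = Circle.exp y →
      IsStrictExtremum g (Circle.exp x)) :
    ∃ α β : ℝ → Circle, Continuous α ∧ Continuous β ∧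
      (∀ z, g z ≤ g (α 0)) ∧ (∀ z, g z ≤ g (β 0)) ∧
      (∀ z, g (α 1) ≤ g z) ∧ (∀ z, g (β 1) ≤ g z) ∧
      ∀ a ∈ Icc (0 : ℝ) 1, ∀ b ∈ Icc (0 : ℝ) 1, α a = β b → IsStrictExtremum g (α a) := by
  have hmem : ∀ u v : ℝ, ∀ a ∈ Icc (0 : ℝ) 1, u + a * (v - u) ∈ uIcc u v := by
    intro u v a ha
    rw [mem_uIcc]
    rcases le_total u v with h | h
    · left; constructor <;> nlinarith [ha.1, ha.2]
    · right; constructor <;> nlinarith [ha.1, ha.2]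
  refine ⟨fun a => Circle.exp (p + a * (q - p)), fun a => Circle.exp (r + a * (s - r)),
    by fun_prop, by fun_prop, by simpa using hp, by simpa using hr, by simpa using hq,
    by simpa using hs, fun a ha b hb h => H _ (hmem _ _ a ha) _ (hmem _ _ b hb) h⟩

lemma Circle.exists_exp_eq_of_base (τ : ℝ) (z : Circle) :
    ∃ x ∈ Ico τ (τ + 2 * π), Circle.exp x = z := by
  obtain ⟨y, rfl⟩ := Circle.exp_surjective z
  obtain ⟨x, hx, h⟩ := Circle.periodic_exp.exists_mem_Ico two_pi_pos y τ
  exact ⟨x, hx, h.symm⟩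

lemma Circle.exp_zero_ne_exp_pi : Circle.exp 0 ≠ Circle.exp π := fun h =>
  pi_pos.ne (Circle.exp_injOn_Ico (a := 0) (b := 2 * π) (by simp) ⟨le_rfl, two_pi_pos⟩
    ⟨pi_pos.le, by linarith [pi_pos]⟩ h)

/-- A continuous function on the circle admits two arcs from its maximum to its minimum that
meet at most at strict extrema. -/
lemma exists_arcs (g : Circle → ℝ) (hg : Continuous g) :
    ∃ α β : ℝ → Circle, Continuous α ∧ Continuous β ∧
      (∀ z, g z ≤ g (α 0)) ∧ (∀ z, g z ≤ g (β 0)) ∧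
      (∀ z, g (α 1) ≤ g z) ∧ (∀ z, g (β 1) ≤ g z) ∧
      ∀ a ∈ Icc (0 : ℝ) 1, ∀ b ∈ Icc (0 : ℝ) 1, α a = β b → IsStrictExtremum g (α a) := by
  -- Two distinct maxima are taken if they exist; otherwise the maximum is strict.
  have hmax : ∃ t t' : Circle, (∀ z, g z ≤ g t) ∧ (∀ z, g z ≤ g t') ∧
      (t = t' → IsStrictExtremum g t) := by
    obtain ⟨t, -, ht⟩ := isCompact_univ.exists_isMaxOn univ_nonempty hg.continuousOn
    have ht : ∀ z, g z ≤ g t := fun z => ht (mem_univ z)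
    by_cases h : ∃ t' ≠ t, g t' = g t
    · obtain ⟨t', hne, h⟩ := h
      exact ⟨t, t', ht, fun z => h ▸ ht z, fun h => absurd h.symm hne⟩
    · push Not at h
      exact ⟨t, t, ht, ht, fun _ => .inl fun z hz => lt_of_le_of_ne (ht z) (h z hz)⟩
  have hmin : ∃ t t' : Circle, (∀ z, g t ≤ g z) ∧ (∀ z, g t' ≤ g z) ∧
      (t = t' → IsStrictExtremum g t) := by
    obtain ⟨t, -, ht⟩ := isCompact_univ.exists_isMinOn univ_nonempty hg.continuousOn
    have ht : ∀ z, g t ≤ g z := fun z => ht (mem_univ z)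
    by_cases h : ∃ t' ≠ t, g t' = g t
    · obtain ⟨t', hne, h⟩ := h
      exact ⟨t, t', ht, fun z => h ▸ ht z, fun h => absurd h.symm hne⟩
    · push Not at h
      exact ⟨t, t, ht, ht, fun _ => .inr fun z hz => lt_of_le_of_ne (ht z) (h z hz).symm⟩
  obtain ⟨t, t', ht, ht', htt⟩ := hmax
  obtain ⟨b, b', hb, hb', hbb⟩ := hmin
  have hπ := two_pi_pos
  -- For constant g, two distinct constant arcs suffice.
  by_cases hconst : g t = g b
  · have hc : ∀ z w, g z ≤ g w := fun z w => (ht z).trans (hconst.le.trans (hb w))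
    refine exists_arcs_of_lifts g 0 0 π π (fun z => hc _ _) (fun z => hc _ _)
      (fun z => hc _ _) (fun z => hc _ _) ?_
    intro x hx y hy h
    simp only [uIcc_self, mem_singleton_iff] at hx hy
    subst hx hy
    exact absurd h Circle.exp_zero_ne_exp_pi
  have hne : ∀ x y, (∀ z, g z ≤ g x) → (∀ z, g y ≤ g z) → x ≠ y := by
    rintro x y hx hy rfl
    exact hconst (le_antisymm ((hx t).trans (hy b)) (hb t))
  obtain ⟨τ, rfl⟩ := Circle.exp_surjective t
  obtain ⟨τ', hτ', rfl⟩ := Circle.exists_exp_eq_of_base τ t'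
  have hinj := Circle.exp_injOn_Ico (a := τ) (b := τ + 2 * π) (by simp)
  -- It suffices to treat two minimum points in a given order on the line.
  have main : ∀ x y, x ∈ Ico τ (τ + 2 * π) → y ∈ Ico τ (τ + 2 * π) → x ≤ y →
      (∀ z, g (Circle.exp x) ≤ g z) → (∀ z, g (Circle.exp y) ≤ g z) →
      (Circle.exp x = Circle.exp y → IsStrictExtremum g (Circle.exp x)) →
      ∃ α β : ℝ → Circle, Continuous α ∧ Continuous β ∧
      (∀ z, g z ≤ g (α 0)) ∧ (∀ z, g z ≤ g (β 0)) ∧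
      (∀ z, g (α 1) ≤ g z) ∧ (∀ z, g (β 1) ≤ g z) ∧
      ∀ a ∈ Icc (0 : ℝ) 1, ∀ b ∈ Icc (0 : ℝ) 1, α a = β b → IsStrictExtremum g (α a) := by
    intro x y hx hy hxy hgx hgy hxy'
    have hτx : τ ≠ x := fun h => hne _ _ ht hgx (h ▸ rfl)
    have hτ'x : τ' ≠ x := fun h => hne _ _ ht' hgx (h ▸ rfl)
    have hτ'y : τ' ≠ y := fun h => hne _ _ ht' hgy (h ▸ rfl)
    have hlt := lt_of_le_of_ne hx.1 hτx
    -- The cyclic order of the extrema decides the pairing, so that the arcs can share only a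
    -- coinciding pair of maxima or of minima.
    rcases lt_or_gt_of_ne hτ'x with h1 | h1
    · refine exists_arcs_of_lifts g τ' x (τ + 2 * π) y ht'
        (by rwa [Circle.exp_add_two_pi]) hgx hgy ?_
      intro c hc d hd hcd
      rw [uIcc_of_le h1.le] at hc
      rw [uIcc_of_ge hy.2.le] at hd
      rcases eq_or_lt_of_le hd.2 with rfl | hd2
      · rw [Circle.exp_add_two_pi] at hcd
        have hcτ := hinj ⟨hτ'.1.trans hc.1, hc.2.trans_lt hx.2⟩ ⟨le_rfl, by linarith⟩ hcd
        have : τ' = τ := le_antisymm (hcτ ▸ hc.1) hτ'.1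
        rw [hcτ]
        exact htt (by rw [this])
      · have hcd' := hinj ⟨hτ'.1.trans hc.1, hc.2.trans_lt hx.2⟩ ⟨hy.1.trans hd.1, hd2⟩ hcd
        subst hcd'
        have e1 : c = x := le_antisymm hc.2 (hxy.trans hd.1)
        have e2 : x = y := le_antisymm hxy (hd.1.trans hc.2)
        rw [e1]
        exact hxy' (by rw [e2])
    · rcases lt_or_gt_of_ne hτ'y with h2 | h2
      · refine exists_arcs_of_lifts g τ x τ' y ht ht' hgx hgy ?_
        intro c hc d hd hcd
        rw [uIcc_of_le hx.1] at hc
        rw [uIcc_of_le h2.le] at hd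
        have := hinj ⟨hc.1, hc.2.trans_lt hx.2⟩ ⟨hτ'.1.trans hd.1, hd.2.trans_lt hy.2⟩ hcd
        linarith [hc.2, hd.1]
      · refine exists_arcs_of_lifts g τ x τ' y ht ht' hgx hgy ?_
        intro c hc d hd hcd
        rw [uIcc_of_le hx.1] at hc
        rw [uIcc_of_ge h2.le] at hd
        have := hinj ⟨hc.1, hc.2.trans_lt hx.2⟩ ⟨hy.1.trans hd.1, hd.2.trans_lt hτ'.2⟩ hcd
        subst this
        have e1 : c = x := le_antisymm hc.2 (hxy.trans hd.1)
        have e2 : x = y := le_antisymm hxy (hd.1.trans hc.2)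
        rw [e1]
        exact hxy' (by rw [e2])
  obtain ⟨x, hx, rfl⟩ := Circle.exists_exp_eq_of_base τ b
  obtain ⟨y, hy, rfl⟩ := Circle.exists_exp_eq_of_base τ b'
  rcases le_total x y with h | h
  · exact main x y hx hy h hb hb' hbb
  · exact main y x hy hx h hb' hb fun h => h ▸ hbb h.symm

/-! ### Rotated coordinates and rhombi -/

/-- The coordinate of `z` along the direction of angle `θ`. -/
noncomputable def alongCoord (θ : ℝ) (z : Plane) : ℝ := z 0 * cos θ + z 1 * sin θ

/-- The coordinate of `z` transverse to the direction of angle `θ`. -/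
noncomputable def transCoord (θ : ℝ) (z : Plane) : ℝ := z 1 * cos θ - z 0 * sin θ

lemma mem_lineOfAngle_iff {θ : ℝ} {p z : Plane} :
    z ∈ lineOfAngle θ p ↔ transCoord θ z = transCoord θ p := by
  simp only [lineOfAngle, transCoord, mem_ofPred_eq]
  constructor <;> intro h <;> linarith

lemma mem_lineOfAngle_add_pi_div_two_iff {θ : ℝ} {p z : Plane} :
    z ∈ lineOfAngle (θ + π / 2) p ↔ alongCoord θ z = alongCoord θ p := by
  simp only [lineOfAngle, alongCoord, mem_ofPred_eq, sin_add_pi_div_two, cos_add_pi_div_two]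
  constructor <;> intro h <;> linarith

lemma dist_sq_eq_coords (θ : ℝ) (z w : Plane) :
    dist z w ^ 2 = (alongCoord θ z - alongCoord θ w) ^ 2 +
      (transCoord θ z - transCoord θ w) ^ 2 := by
  rw [EuclideanSpace.dist_eq, Real.sq_sqrt (by positivity)]
  simp only [Fin.sum_univ_two, Real.dist_eq, sq_abs, alongCoord, transCoord]
  linear_combination (-((z 0 - w 0) ^ 2 + (z 1 - w 1) ^ 2)) * sin_sq_add_cos_sq θ

lemma eq_of_coords {θ : ℝ} {z w : Plane} (h : alongCoord θ z = alongCoord θ w)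
    (h' : transCoord θ z = transCoord θ w) : z = w := by
  have := dist_sq_eq_coords θ z w
  rw [h, h'] at this
  simpa using this

lemma alongCoord_lineMap (θ : ℝ) (p q : Plane) (r : ℝ) :
    alongCoord θ (AffineMap.lineMap p q r) =
      alongCoord θ p + r * (alongCoord θ q - alongCoord θ p) := by
  simp only [AffineMap.lineMap_apply, alongCoord, vsub_eq_sub, vadd_eq_add, PiLp.add_apply,
    PiLp.smul_apply, PiLp.sub_apply, smul_eq_mul]
  ring

lemma transCoord_lineMap (θ : ℝ) (p q : Plane) (r : ℝ) :
    transCoord θ (AffineMap.lineMap p q r) =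
      transCoord θ p + r * (transCoord θ q - transCoord θ p) := by
  simp only [AffineMap.lineMap_apply, transCoord, vsub_eq_sub, vadd_eq_add, PiLp.add_apply,
    PiLp.smul_apply, PiLp.sub_apply, smul_eq_mul]
  ring

lemma affineSpan_pair_eq_lineOfAngle {θ : ℝ} {p q : Plane} (hpq : p ≠ q)
    (h : transCoord θ p = transCoord θ q) : (line[ℝ, p, q] : Set Plane) = lineOfAngle θ p := by
  ext z
  rw [SetLike.mem_coe, mem_affineSpan_pair_iff_exists_lineMap_eq, mem_lineOfAngle_iff]
  constructor
  · rintro ⟨r, rfl⟩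
    rw [transCoord_lineMap, h]; ring
  · intro hz
    have hne : alongCoord θ q - alongCoord θ p ≠ 0 :=
      fun h0 => hpq (eq_of_coords (sub_eq_zero.1 h0).symm h)
    refine ⟨(alongCoord θ z - alongCoord θ p) / (alongCoord θ q - alongCoord θ p),
      eq_of_coords (θ := θ) ?_ ?_⟩
    · rw [alongCoord_lineMap, div_mul_cancel₀ _ hne]; ring
    · rw [transCoord_lineMap, h, hz, h]; ring

lemma transCoord_add_pi_div_two (θ : ℝ) (z : Plane) :
    transCoord (θ + π / 2) z = -alongCoord θ z := by
  simp only [transCoord, alongCoord, sin_add_pi_div_two, cos_add_pi_div_two]; ring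

/-- Two nondegenerate chords in perpendicular directions that bisect each other are the diagonals
of a rhombus. -/
lemma isRhombusOfAngle_of_coords {θ : ℝ} {p q r s : Plane} (hpq : p ≠ q) (hrs : r ≠ s)
    (h1 : 2 * transCoord θ p = transCoord θ r + transCoord θ s)
    (h2 : 2 * transCoord θ q = transCoord θ r + transCoord θ s)
    (h3 : 2 * alongCoord θ r = alongCoord θ p + alongCoord θ q)
    (h4 : 2 * alongCoord θ s = alongCoord θ p + alongCoord θ q) :
    IsRhombusOfAngle θ ![p, r, q, s] := by
  have hT : transCoord θ p = transCoord θ q := by linarith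
  have hA : alongCoord θ r = alongCoord θ s := by linarith
  have hTrs : transCoord θ r ≠ transCoord θ s := fun h => hrs (eq_of_coords hA h)
  have hApq : alongCoord θ p ≠ alongCoord θ q := fun h => hpq (eq_of_coords h hT)
  have side : ∀ {a b c d : Plane}, (alongCoord θ a - alongCoord θ b) ^ 2 =
      (alongCoord θ c - alongCoord θ d) ^ 2 → (transCoord θ a - transCoord θ b) ^ 2 =
      (transCoord θ c - transCoord θ d) ^ 2 → dist a b = dist c d := by
    intro a b c d h h'
    rw [← sq_eq_sq₀ dist_nonneg dist_nonneg, dist_sq_eq_coords θ, dist_sq_eq_coords θ, h, h']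
  have hpr : p ≠ r := by rintro rfl; exact hTrs (by linarith)
  have hps : p ≠ s := by rintro rfl; exact hTrs (by linarith)
  have hqr : q ≠ r := by rintro rfl; exact hTrs (by linarith)
  have hqs : q ≠ s := by rintro rfl; exact hTrs (by linarith)
  have hAp : alongCoord θ p = 2 * alongCoord θ s - alongCoord θ q := by linarith
  have hTr : transCoord θ r = 2 * transCoord θ q - transCoord θ s := by linarith
  refine ⟨⟨?_, ?_⟩, affineSpan_pair_eq_lineOfAngle hpq hT, affineSpan_pair_eq_lineOfAngle hrs ?_⟩
  · intro i j hij
    fin_cases i <;> fin_cases j <;>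
      first
      | rfl
      | exact absurd hij ‹_›
      | exact absurd hij (Ne.symm ‹_›)
  · have e1 : dist r q = dist p r := side (by rw [hA, hAp]; ring) (by rw [hT]; ring)
    have e2 : dist q s = dist p r := side (by rw [hA, hAp]; ring) (by rw [hT, hTr]; ring)
    have e3 : dist s p = dist p r := side (by rw [hA]; ring) (by rw [hT, hTr]; ring)
    have key : ∀ i : Fin 4, dist ((![p, r, q, s] : Fin 4 → Plane) i)
        ((![p, r, q, s] : Fin 4 → Plane) (i + 1)) = dist p r := by
      intro i
      fin_cases i
      exacts [rfl, e1, e2, e3]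
    intro i j
    rw [key, key]
  · rw [transCoord_add_pi_div_two, transCoord_add_pi_div_two]
    exact congrArg Neg.neg hA

/-- A mean of two values is extremal only if both are; this collapses degenerate zeros to a single
point. -/
lemma IsStrictExtremum.eq_of_add_eq {X : Type*} {g : X → ℝ} {p : X} (hp : IsStrictExtremum g p)
    {x y : X} (h : g x + g y = 2 * g p) : x = p ∧ y = p := by
  rcases hp with hp | hp
  · have hle : ∀ z, g z ≤ g p := fun z => by
      rcases eq_or_ne z p with rfl | hz
      exacts [le_rfl, (hp z hz).le]
    constructor <;> by_contra hne
    · linarith [hp x hne, hle y]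
    · linarith [hp y hne, hle x]
  · have hle : ∀ z, g p ≤ g z := fun z => by
      rcases eq_or_ne z p with rfl | hz
      exacts [le_rfl, (hp z hz).le]
    constructor <;> by_contra hne
    · linarith [hp x hne, hle y]
    · linarith [hp y hne, hle x]

lemma IsStrictExtremum.eq_of_apply_eq {X : Type*} {g : X → ℝ} {p : X}
    (hp : IsStrictExtremum g p) {x : X} (h : g x = g p) : x = p :=
  (hp.eq_of_add_eq (by rw [h]; ring : g x + g x = 2 * g p)).1

/-! ### Rhombi of angles near a given one -/

/-- If no point of the curve is a vertex of its bounding box in direction `θ₀` that is isolated on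
both sides, then the curve inscribes rhombi of all angles close to `θ₀`. -/
theorem eventually_inscribesRhombusOfAngle {γ : Circle → Plane} (hγ : IsJordanCurve γ) (θ₀ : ℝ)
    (hθ₀ : ¬ ∃ c, IsStrictExtremum (fun z => transCoord θ₀ (γ z)) c ∧
      IsStrictExtremum (fun z => alongCoord θ₀ (γ z)) c) :
    ∀ᶠ θ in nhds θ₀, InscribesRhombusOfAngle γ θ := by
  have hγc := hγ.continuous
  obtain ⟨α, β, hα, hβ, hα0, hβ0, hα1, hβ1, hαβ⟩ :=
    exists_arcs (fun z => transCoord θ₀ (γ z)) (by unfold transCoord; fun_prop)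
  obtain ⟨μ, ν, hμ, hν, hμ0, hν0, hμ1, hν1, hμν⟩ :=
    exists_arcs (fun z => alongCoord θ₀ (γ z)) (by unfold alongCoord; fun_prop)
  let h : ℝ → Circle → ℝ := fun θ z => transCoord θ (γ z)
  let k : ℝ → Circle → ℝ := fun θ z => alongCoord θ (γ z)
  change ∀ z, h θ₀ z ≤ h θ₀ (α 0) at hα0
  change ∀ z, h θ₀ z ≤ h θ₀ (β 0) at hβ0
  change ∀ z, h θ₀ (α 1) ≤ h θ₀ z at hα1
  change ∀ z, h θ₀ (β 1) ≤ h θ₀ z at hβ1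
  change ∀ z, k θ₀ z ≤ k θ₀ (μ 0) at hμ0
  change ∀ z, k θ₀ z ≤ k θ₀ (ν 0) at hν0
  change ∀ z, k θ₀ (μ 1) ≤ k θ₀ z at hμ1
  change ∀ z, k θ₀ (ν 1) ≤ k θ₀ z at hν1
  -- The arcs stay those of `θ₀`; only the coordinates vary with θ.
  let F : ℝ → (Fin 4 → ℝ) → Fin 4 → ℝ := fun θ x =>
    ![2 * h θ (α (x 0)) - (h θ (μ (x 2)) + h θ (ν (x 3))),
      2 * h θ (β (x 1)) - (h θ (μ (x 2)) + h θ (ν (x 3))),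
      2 * k θ (μ (x 2)) - (k θ (α (x 0)) + k θ (β (x 1))),
      2 * k θ (ν (x 3)) - (k θ (α (x 0)) + k θ (β (x 1)))]
  have hF : Continuous fun q : ℝ × (Fin 4 → ℝ) => F q.1 q.2 := by
    refine continuous_pi fun i => ?_
    fin_cases i <;> simp [F, h, k, transCoord, alongCoord] <;> fun_prop
  have hFθ : ∀ θ, Continuous (F θ) := fun θ => hF.comp (Continuous.prodMk_right θ)
  have hzero : ∀ {θ x}, F θ x = 0 →
      2 * h θ (α (x 0)) = h θ (μ (x 2)) + h θ (ν (x 3)) ∧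
      2 * h θ (β (x 1)) = h θ (μ (x 2)) + h θ (ν (x 3)) ∧
      2 * k θ (μ (x 2)) = k θ (α (x 0)) + k θ (β (x 1)) ∧
      2 * k θ (ν (x 3)) = k θ (α (x 0)) + k θ (β (x 1)) := by
    intro θ x hx
    exact ⟨sub_eq_zero.1 (congrFun hx 0), sub_eq_zero.1 (congrFun hx 1),
      sub_eq_zero.1 (congrFun hx 2), sub_eq_zero.1 (congrFun hx 3)⟩
  let D : Set (Fin 4 → ℝ) := Icc 0 1 ∩
    {x | (∃ i, x i = 0 ∨ x i = 1) ∨ α (x 0) = β (x 1) ∨ μ (x 2) = ν (x 3)}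
  have hD : IsCompact D := by
    refine isCompact_Icc.inter_right ?_
    have hB : IsClosed {x : Fin 4 → ℝ | ∃ i, x i = 0 ∨ x i = 1} := by
      rw [ofPred_exists]
      exact isClosed_iUnion_of_finite fun i => IsClosed.union
        (isClosed_eq (by fun_prop) (by fun_prop)) (isClosed_eq (by fun_prop) (by fun_prop))
    exact hB.union (IsClosed.union (isClosed_eq (by fun_prop) (by fun_prop))
      (isClosed_eq (by fun_prop) (by fun_prop)))
  have hne : ∀ x ∈ D, F θ₀ x ≠ 0 := by
    rintro x ⟨hx, hxD⟩ hx0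
    obtain ⟨e1, e2, e3, e4⟩ := hzero hx0
    have hcoord : ∀ i, x i ∈ Icc (0 : ℝ) 1 := fun i => ⟨hx.1 i, hx.2 i⟩
    have inj : ∀ {z w}, h θ₀ z = h θ₀ w → k θ₀ z = k θ₀ w → z = w :=
      fun hh hk => hγ.injective (eq_of_coords hk hh)
    -- A common point of α and β is a strict extremum of h, hence equals both ends of the other
    -- chord, and so is a strict extremum of k too.
    have c1 : α (x 0) ≠ β (x 1) := by
      intro hd
      have hs := hαβ _ (hcoord 0) _ (hcoord 1) hd
      obtain ⟨hu, hv⟩ := hs.eq_of_add_eq e1.symm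
      have hs' := hμν _ (hcoord 2) _ (hcoord 3) (hu.trans hv.symm)
      exact hθ₀ ⟨_, hs, hu ▸ hs'⟩
    have c2 : μ (x 2) ≠ ν (x 3) := by
      intro hd
      have hs := hμν _ (hcoord 2) _ (hcoord 3) hd
      obtain ⟨hu, hv⟩ := hs.eq_of_add_eq e3.symm
      exact c1 (hu.trans hv.symm)
    -- A boundary zero puts one end at an extremum, which makes the other chord degenerate.
    have cmax : ∀ z, (∀ w, h θ₀ w ≤ h θ₀ z) → 2 * h θ₀ z ≠ h θ₀ (μ (x 2)) + h θ₀ (ν (x 3)) :=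
      fun z hz he => c2 (inj (by linarith [hz (μ (x 2)), hz (ν (x 3))]) (by linarith))
    have cmin : ∀ z, (∀ w, h θ₀ z ≤ h θ₀ w) → 2 * h θ₀ z ≠ h θ₀ (μ (x 2)) + h θ₀ (ν (x 3)) :=
      fun z hz he => c2 (inj (by linarith [hz (μ (x 2)), hz (ν (x 3))]) (by linarith))
    have kmax : ∀ z, (∀ w, k θ₀ w ≤ k θ₀ z) → 2 * k θ₀ z ≠ k θ₀ (α (x 0)) + k θ₀ (β (x 1)) :=
      fun z hz he => c1 (inj (by linarith) (by linarith [hz (α (x 0)), hz (β (x 1))]))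
    have kmin : ∀ z, (∀ w, k θ₀ z ≤ k θ₀ w) → 2 * k θ₀ z ≠ k θ₀ (α (x 0)) + k θ₀ (β (x 1)) :=
      fun z hz he => c1 (inj (by linarith) (by linarith [hz (α (x 0)), hz (β (x 1))]))
    rcases hxD with ⟨i, hi⟩ | hd | hd
    · fin_cases i <;> simp only [Fin.zero_eta, Fin.mk_one, Fin.reduceFinMk] at hi <;>
        rcases hi with hi | hi
      · exact cmax _ hα0 (hi ▸ e1)
      · exact cmin _ hα1 (hi ▸ e1)
      · exact cmax _ hβ0 (hi ▸ e2)
      · exact cmin _ hβ1 (hi ▸ e2)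
      · exact kmax _ hμ0 (hi ▸ e3)
      · exact kmin _ hμ1 (hi ▸ e3)
      · exact kmax _ hν0 (hi ▸ e4)
      · exact kmin _ hν1 (hi ▸ e4)
    · exact c1 hd
    · exact c2 hd
  -- At `θ₀` the left side is 0 and the right side positive; compactness of D makes this uniform.
  have hclose : ∀ᶠ θ in nhds θ₀, ∀ x ∈ D, dist (F θ x) (F θ₀ x) < ‖F θ₀ x‖ := by
    refine hD.eventually_forall_of_forall_eventually fun x hx => ?_
    refine Filter.Tendsto.eventually_lt (f := fun q : ℝ × (Fin 4 → ℝ) =>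
      dist (F q.1 q.2) (F θ₀ q.2)) (g := fun q => ‖F θ₀ q.2‖)
      ((hF.dist ((hFθ θ₀).comp continuous_snd)).tendsto (θ₀, x))
      (((hFθ θ₀).comp continuous_snd).norm.tendsto (θ₀, x)) ?_
    simpa using hne x hx
  filter_upwards [hclose] with θ hθ
  obtain ⟨x, hx, hx0⟩ := exists_eq_zero_of_dist_lt (hFθ θ₀) (hFθ θ)
    (by
      intro x _ i hi
      fin_cases i <;> simp only [Fin.zero_eta, Fin.mk_one, Fin.reduceFinMk] at hi <;>
        simp [F, hi]
      · linarith [hα0 (μ (x 2)), hα0 (ν (x 3))]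
      · linarith [hβ0 (μ (x 2)), hβ0 (ν (x 3))]
      · linarith [hμ0 (α (x 0)), hμ0 (β (x 1))]
      · linarith [hν0 (α (x 0)), hν0 (β (x 1))])
    (by
      intro x _ i hi
      fin_cases i <;> simp only [Fin.zero_eta, Fin.mk_one, Fin.reduceFinMk] at hi <;>
        simp [F, hi]
      · linarith [hα1 (μ (x 2)), hα1 (ν (x 3))]
      · linarith [hβ1 (μ (x 2)), hβ1 (ν (x 3))]
      · linarith [hμ1 (α (x 0)), hμ1 (β (x 1))]
      · linarith [hν1 (α (x 0)), hν1 (β (x 1))])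
    (fun x hx i hi => hθ x ⟨hx, .inl ⟨i, hi⟩⟩)
  have hxD : x ∉ D := by
    intro hxD
    have := hθ x hxD
    rw [hx0, dist_zero_left] at this
    exact lt_irrefl _ this
  obtain ⟨e1, e2, e3, e4⟩ := hzero hx0
  have c1 : γ (α (x 0)) ≠ γ (β (x 1)) :=
    fun hd => hxD ⟨hx, .inr (.inl (hγ.injective hd))⟩
  have c2 : γ (μ (x 2)) ≠ γ (ν (x 3)) :=
    fun hd => hxD ⟨hx, .inr (.inr (hγ.injective hd))⟩
  refine ⟨_, isRhombusOfAngle_of_coords c1 c2 e1 e2 e3 e4, fun i => ?_⟩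
  fin_cases i <;> simp

/-! ### The direction of a diameter -/

/-- In the direction of a diameter of the curve no vertex of the bounding box is isolated. -/
lemma exists_angle_forall_not_isStrictExtremum {γ : Circle → Plane} (hγ : IsJordanCurve γ) :
    ∃ θ₀ : ℝ, ¬ ∃ c, IsStrictExtremum (fun z => transCoord θ₀ (γ z)) c ∧
      IsStrictExtremum (fun z => alongCoord θ₀ (γ z)) c := by
  have hγc := hγ.continuous
  obtain ⟨⟨a, b⟩, -, hab⟩ := (isCompact_univ (X := Circle × Circle)).exists_isMaxOn
    univ_nonempty (f := fun q => dist (γ q.1) (γ q.2)) (by fun_prop)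
  replace hab : ∀ z w, dist (γ z) (γ w) ≤ dist (γ a) (γ b) :=
    fun z w => isMaxOn_iff.1 hab (z, w) (mem_univ _)
  have hne : a ≠ b := by
    rintro rfl
    have h1 := hab (Circle.exp 0) (Circle.exp π)
    rw [dist_self] at h1
    exact Circle.exp_zero_ne_exp_pi (hγ.injective (dist_le_zero.1 h1))
  obtain ⟨ρ, θ, hρ, hcos, hsin⟩ : ∃ ρ θ : ℝ, 0 ≤ ρ ∧ ρ * cos θ = γ b 0 - γ a 0 ∧
      ρ * sin θ = γ b 1 - γ a 1 :=
    ⟨_, _, norm_nonneg _, Complex.norm_mul_cos_arg ⟨γ b 0 - γ a 0, γ b 1 - γ a 1⟩,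
      Complex.norm_mul_sin_arg ⟨γ b 0 - γ a 0, γ b 1 - γ a 1⟩⟩
  have hT : transCoord θ (γ a) = transCoord θ (γ b) := by
    simp only [transCoord]
    linear_combination cos θ * hsin - sin θ * hcos
  have hA : alongCoord θ (γ b) - alongCoord θ (γ a) = ρ := by
    simp only [alongCoord]
    linear_combination (-cos θ) * hcos - sin θ * hsin + ρ * sin_sq_add_cos_sq θ
  refine ⟨θ, ?_⟩
  rintro ⟨c, hcT, hcA⟩
  suffices transCoord θ (γ a) = transCoord θ (γ c) from
    hne ((hcT.eq_of_apply_eq this).trans (hcT.eq_of_apply_eq (hT.symm.trans this)).symm)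
  have hd : dist (γ a) (γ b) ^ 2 = (alongCoord θ (γ b) - alongCoord θ (γ a)) ^ 2 := by
    rw [dist_sq_eq_coords θ, hT]; ring
  have hpos : 0 ≤ alongCoord θ (γ b) - alongCoord θ (γ a) := hA ▸ hρ
  have bound : ∀ w, (alongCoord θ (γ c) - alongCoord θ (γ w)) ^ 2 +
      (transCoord θ (γ c) - transCoord θ (γ w)) ^ 2 ≤
      (alongCoord θ (γ b) - alongCoord θ (γ a)) ^ 2 := by
    intro w
    rw [← hd, ← dist_sq_eq_coords]
    exact pow_le_pow_left₀ dist_nonneg (hab c w) 2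
  have sq_zero : ∀ t : ℝ, t ^ 2 ≤ 0 → t = 0 := fun t ht =>
    pow_eq_zero_iff two_ne_zero |>.1 (le_antisymm ht (sq_nonneg t))
  -- The far end of the diameter is already at least a diameter away from c in the along coordinate
  -- alone, so their transverse coordinates agree.
  rcases hcA with hcA | hcA
  · have hle : alongCoord θ (γ b) ≤ alongCoord θ (γ c) := by
      rcases eq_or_ne b c with rfl | h
      exacts [le_rfl, (hcA b h).le]
    have h1 : (alongCoord θ (γ b) - alongCoord θ (γ a)) ^ 2 ≤
        (alongCoord θ (γ c) - alongCoord θ (γ a)) ^ 2 :=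
      pow_le_pow_left₀ hpos (by linarith) 2
    linarith [sq_zero (transCoord θ (γ c) - transCoord θ (γ a)) (by linarith [bound a])]
  · have hle : alongCoord θ (γ c) ≤ alongCoord θ (γ a) := by
      rcases eq_or_ne a c with rfl | h
      exacts [le_rfl, (hcA a h).le]
    have h1 : (alongCoord θ (γ b) - alongCoord θ (γ a)) ^ 2 ≤
        (alongCoord θ (γ b) - alongCoord θ (γ c)) ^ 2 :=
      pow_le_pow_left₀ hpos (by linarith) 2
    linarith [sq_zero (transCoord θ (γ c) - transCoord θ (γ b)) (by linarith [bound b])]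

lemma isSpecialCornerOfAngle_of_isStrictExtremum {γ : Circle → Plane} {θ : ℝ} {c : Circle}
    (hT : IsStrictExtremum (fun z => transCoord θ (γ z)) c)
    (hA : IsStrictExtremum (fun z => alongCoord θ (γ z)) c) :
    IsSpecialCornerOfAngle γ θ (γ c) := by
  refine ⟨mem_range_self c, ?_, ?_⟩ <;> refine Subset.antisymm ?_ ?_
  · rintro _ ⟨hz, w, rfl⟩
    rw [mem_lineOfAngle_iff] at hz
    rw [hT.eq_of_apply_eq hz, mem_singleton_iff]
  · rintro _ rfl
    exact ⟨mem_lineOfAngle_iff.2 rfl, mem_range_self c⟩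
  · rintro _ ⟨hz, w, rfl⟩
    rw [mem_lineOfAngle_add_pi_div_two_iff] at hz
    rw [hA.eq_of_apply_eq hz, mem_singleton_iff]
  · rintro _ rfl
    exact ⟨mem_lineOfAngle_add_pi_div_two_iff.2 rfl, mem_range_self c⟩

theorem mainTheorem1 (γ : Circle → Plane) (hγ : IsJordanCurve γ) :
    (∃ a b : ℝ, a < b ∧ ∀ θ ∈ Ioo a b, InscribesRhombusOfAngle γ θ) ∧
    ((¬ ∃ p : Plane, IsSpecialCorner γ p) → ∀ θ : ℝ, InscribesRhombusOfAngle γ θ) := by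
  constructor
  · obtain ⟨θ₀, hθ₀⟩ := exists_angle_forall_not_isStrictExtremum hγ
    obtain ⟨ε, hε, h⟩ := Metric.eventually_nhds_iff_ball.1
      (eventually_inscribesRhombusOfAngle hγ θ₀ hθ₀)
    refine ⟨θ₀ - ε, θ₀ + ε, by linarith, fun θ hθ => h θ ?_⟩
    rwa [Real.ball_eq_Ioo]
  · intro hno θ
    refine (eventually_inscribesRhombusOfAngle hγ θ ?_).self_of_nhds
    rintro ⟨c, hT, hA⟩
    exact hno ⟨γ c, θ, isSpecialCornerOfAngle_of_isStrictExtremum hT hA⟩
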